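/- Model. A network is a finite simple graph $G$ (not necessarily connected) on $n$ vertices, each carrying a distinct identifier, with its incident edges numbered by ports. All vertices run the same deterministic algorithm; initially a vertex knows only its own identifier and its own degree (the algorithm may depend on the parameters $\alpha,\varepsilon$, but $n$ is not known). Computation proceeds in synchronous rounds; in each round every vertex sends a finite bit string (possibly empty) through each of its ports, receives the strings sent to it, and performs an arbitrary local computation. After a fixed number of rounds every vertex stops and decides whether it belongs to the output set. In the $\mathcal{LOCAL}$ model the message length is unrestricted; in the $\mathcal{CONGEST}$ model every message has $O(\log n)$ bits. The arboricity of $G=(V,E)$ is $\max_{U\subseteq V,\ |U|\ge 2}\left\lceil \frac{|E(U)|}{|U|-1}\right\rceil$, where $E(U)$ is the set of edges with both endpoints in $U$ (and $0$ if $|V|\le 1$). A $t$-VC of $G$ is a vertex cover of $G$ whose size is at most $t$ times the minimum size of a vertex cover of $G$. Theorem. There is an absolute constant $B$, and for every $E>0$ there is a constant $C=C(E)$, such that for all real $\alpha\ge 1$ and $0<\varepsilon\le E$ there is a deterministic distributed algorithm with the following property. With $x=\max\{\alpha/\varepsilon,3\}$, it runs for at most $$C\cdot\frac{\log x}{\varepsilon\,\log\log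 x}$$ rounds, and on every network whose graph has arboricity at most $\alpha$ (for every choice of identifiers and port numbers) it computes a $(2+\varepsilon)$-VC, using only messages of at most $B\log n$ bits. In particular, for any $\alpha\ge1$ and any $0<\varepsilon\le O(1)$, a $(2+\varepsilon)$-VC of any graph of arboricity at most $\alpha$ can be computed in $O\!\left(\frac{\log(\alpha/\varepsilon)}{\varepsilon\log\log(\alpha/\varepsilon)}\right)$ rounds in both the $\mathcal{LOCAL}$ and the $\mathcal{CONGEST}$ model. -/

import Mathlib

namespace DistVC

/-- The arboricity of a finite graph: the maximum over vertex sets `U` with at least two elements of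
`⌈|E(U)| / (|U| - 1)⌉`, where `E(U)` is the set of edges with both endpoints in `U`
(it is `0` if there is no such `U`). -/
noncomputable def arboricity {V : Type*} [Fintype V] (G : SimpleGraph V) : ℕ :=
  ((Finset.univ : Finset (Finset V)).filter (fun U => 2 ≤ U.card)).sup
    (fun U => ⌈(({e ∈ G.edgeSet | ∀ v ∈ e, v ∈ U}.ncard : ℕ) : ℝ) / ((U.card : ℝ) - 1)⌉₊)

/-- `S` is a `t`-approximate minimum vertex cover of `G` (a `t`-VC): it is a vertex cover, and its
size is at most `t` times the size of every vertex cover, hence of a minimum one. -/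
def IsApproxVertexCover {V : Type*} (G : SimpleGraph V) (t : ℝ) (S : Set V) : Prop :=
  G.IsVertexCover S ∧ ∀ S' : Set V, G.IsVertexCover S' → (S.ncard : ℝ) ≤ t * (S'.ncard : ℝ)

/-- Messages are finite bit strings. The empty string stands for sending nothing. -/
abbrev Message : Type := List Bool

/-- A deterministic synchronous message-passing algorithm in which every vertex outputs one bit.
All vertices run the same code. A vertex knows at the start only its own identifier and its own
degree `d`; its incident edges are visible to it as the ports `0, …, d - 1`. In every round it
sends one message through each of its ports, receives one message through each of its ports, and
updates its state by an arbitrary local computation. After `rounds` rounds it stops and outputs. -/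
structure Algorithm where
  /-- The local states of a vertex of degree `d`. -/
  State : ℕ → Type
  /-- The state before the first round, from the degree `d` and the identifier. -/
  start : (d : ℕ) → ℕ → State d
  /-- The message sent through a given port. -/
  send : {d : ℕ} → State d → Fin d → Message
  /-- The new state, from the old one and the messages received through all ports. -/
  receive : {d : ℕ} → State d → (Fin d → Message) → State d
  /-- The number of rounds. -/
  rounds : ℕ
  /-- The output bit. -/
  output : {d : ℕ} → State d → Bool

/-- A network with underlying graph `G`: distinct identifiers for the vertices, and for every
vertex a numbering of its incident edges by ports. -/
structure Network {V : Type*} [Fintype V] (G : SimpleGraph V) [DecidableRel G.Adj] where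
  /-- The identifiers. -/
  ident : V → ℕ
  ident_injective : Function.Injective ident
  /-- The neighbor behind each port. -/
  port : (v : V) → Fin (G.degree v) ≃ G.neighborSet v

namespace Network

variable {V : Type*} [Fintype V] {G : SimpleGraph V} [DecidableRel G.Adj]

/-- The neighbor of `v` behind its port `p`. -/
def nbr (N : Network G) (v : V) (p : Fin (G.degree v)) : V := (N.port v p : V)

/-- The port of `nbr v p` that leads back to `v`. -/
def backPort (N : Network G) (v : V) (p : Fin (G.degree v)) : Fin (G.degree (N.nbr v p)) :=
  (N.port (N.nbr v p)).symm ⟨v, G.adj_symm (N.port v p).2⟩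

end Network

namespace Algorithm

variable {V : Type*} [Fintype V] {G : SimpleGraph V} [DecidableRel G.Adj]

/-- The state of every vertex after `t` rounds. -/
def stateAfter (A : Algorithm) (N : Network G) : ℕ → (v : V) → A.State (G.degree v)
  | 0, v => A.start (G.degree v) (N.ident v)
  | t + 1, v => A.receive (A.stateAfter N t v)
      (fun p => A.send (A.stateAfter N t (N.nbr v p)) (N.backPort v p))

/-- The set of vertices that output `true` when they stop. -/
def selected (A : Algorithm) (N : Network G) : Set V :=
  {v | A.output (A.stateAfter N A.rounds v) = true}

/-- In the execution on `N`, every message has at most `b` bits. -/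
def MessagesBoundedBy (A : Algorithm) (N : Network G) (b : ℝ) : Prop :=
  ∀ t < A.rounds, ∀ (v : V) (p : Fin (G.degree v)),
    ((A.send (A.stateAfter N t v) p).length : ℝ) ≤ b

end Algorithm

end DistVC

/-! A primal-dual argument. Vertices of degree at least `D = α + 2α/ε` enter the cover at once; by
sparsity, at most `ε/2 * |S|` of them lie outside a given cover `S` (`card_high_degree_le`). The
others build a fractional matching, where the load of a vertex is the total weight on its edges, and
output those of load at least `1 - 2δ`. The loads sum to at most twice the number of low-degree
vertices in `S` (`sum_load_le`), so rounding at `1 - 2δ` costs a factor `2 / (1 - 2δ) = 2 + ε/2`.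

Speed: a live vertex offers `δ / k` to each of its `k` live neighbors, and a neighbor that stays
live must have accepted. If the live degrees are `d₀, ..., d_T`, a vertex that stays live therefore
gains at least `δ * ∑ d_{i+1} / d_i`. While some live neighbor remains, the ratios have product at
least `1 / D`, so by AM-GM the gain is at least `δ * T * D^(-1/T)`. Once this reaches `1`, no edge
has two live ends (`isVertexCover`). Taking `T` of order `log x / (ε log log x)` suffices
(`one_div_le_iterations`). -/

namespace DistVC

open Finset

/-! ### Sparsity: counting edges at high-degree vertices. -/

section Arboricity

variable {V : Type*} [Fintype V] {G : SimpleGraph V}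

theorem ncard_edges_le_of_arboricity_le {α : ℝ} (hα : 0 ≤ α) (h : (arboricity G : ℝ) ≤ α)
    (U : Finset V) :
    (({e ∈ G.edgeSet | ∀ v ∈ e, v ∈ U}.ncard : ℕ) : ℝ) ≤ α * U.card := by
  classical
  by_cases hU : 2 ≤ U.card
  · have hU' : (2 : ℝ) ≤ U.card := by exact_mod_cast hU
    have h1 : ⌈(({e ∈ G.edgeSet | ∀ v ∈ e, v ∈ U}.ncard : ℕ) : ℝ) / ((U.card : ℝ) - 1)⌉₊
        ≤ arboricity G :=
      Finset.le_sup (f := fun U : Finset V =>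
        ⌈(({e ∈ G.edgeSet | ∀ v ∈ e, v ∈ U}.ncard : ℕ) : ℝ) / ((U.card : ℝ) - 1)⌉₊)
        (by simpa using hU)
    have h2 := (Nat.le_ceil ((({e ∈ G.edgeSet | ∀ v ∈ e, v ∈ U}.ncard : ℕ) : ℝ) /
      ((U.card : ℝ) - 1))).trans ((Nat.cast_le.mpr h1).trans h)
    rw [div_le_iff₀ (by linarith)] at h2
    nlinarith
  · have h0 : {e ∈ G.edgeSet | ∀ v ∈ e, v ∈ U} = ∅ := by
      rw [Set.eq_empty_iff_forall_notMem]
      rintro e ⟨he, hv⟩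
      induction e with
      | _ a b =>
        have hab : a ≠ b := G.ne_of_adj he
        exact hU (Finset.one_lt_card.mpr ⟨a, hv a (by simp), b, hv b (by simp), hab⟩)
    rw [h0]
    simp only [Set.ncard_empty, Nat.cast_zero]
    positivity

/-- In a graph of arboricity at most `α`, only few vertices of degree at least `D` lie outside a
given vertex cover. -/
theorem card_high_degree_le [DecidableEq V] [DecidableRel G.Adj] {α D : ℝ} (hα : 0 ≤ α)
    (h : (arboricity G : ℝ) ≤ α) (S : Finset V) (hS : G.IsVertexCover (S : Set V)) :
    (D - α) * ({v | v ∉ S ∧ D ≤ G.degree v} : Finset V).card ≤ α * S.card := by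
  set H : Finset V := {v | v ∉ S ∧ D ≤ G.degree v} with hH
  have hnb : ∀ v ∈ H, ∀ u, G.Adj v u → u ∈ S := by
    intro v hv u huv
    have hv' : v ∉ S := by simp [hH] at hv; exact hv.1
    rcases hS huv with h1 | h1
    · exact absurd h1 hv'
    · exact h1
  -- Vertices outside a cover are independent, so each edge at `H` ends in `S` and is counted once.
  let F : Finset (Sym2 V) :=
    (H.sigma fun v => G.neighborFinset v).image fun p => s(p.1, p.2)
  have hF : F.card = ∑ v ∈ H, G.degree v := by
    rw [Finset.card_image_of_injOn, Finset.card_sigma]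
    · rfl
    · rintro ⟨a, b⟩ hab ⟨c, d⟩ hcd he
      simp only [coe_sigma, Set.mem_sigma_iff, mem_coe, SimpleGraph.mem_neighborFinset]
        at hab hcd
      have ha : a ∉ S := (Finset.mem_filter.mp hab.1).2.1
      have hd : d ∈ S := hnb _ hcd.1 _ hcd.2
      rcases Sym2.eq_iff.mp he with ⟨h1, h2⟩ | ⟨h1, h2⟩
      · simp only at h1 h2
        subst h1 h2
        rfl
      · simp only at h1 h2
        subst h1
        exact absurd hd ha
  have hsub : (F : Set (Sym2 V)) ⊆ {e ∈ G.edgeSet | ∀ v ∈ e, v ∈ H ∪ S} := by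
    intro e he
    simp only [F, coe_image, Set.mem_image, mem_coe, mem_sigma,
      SimpleGraph.mem_neighborFinset] at he
    obtain ⟨⟨a, b⟩, ⟨h1, h2⟩, rfl⟩ := he
    refine ⟨h2, ?_⟩
    intro v hv
    rcases Sym2.mem_iff.mp hv with rfl | rfl
    · exact Finset.mem_union_left _ h1
    · exact Finset.mem_union_right _ (hnb _ h1 _ h2)
  have h1 : F.card ≤ ({e ∈ G.edgeSet | ∀ v ∈ e, v ∈ H ∪ S}).ncard := by
    rw [← Set.ncard_coe_finset]
    exact Set.ncard_le_ncard hsub (Set.toFinite _)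
  have h2 : (F.card : ℝ) ≤ α * (H ∪ S).card :=
    (Nat.cast_le.mpr h1).trans (ncard_edges_le_of_arboricity_le hα h _)
  have h3 : D * H.card ≤ (F.card : ℝ) := by
    rw [hF]
    push_cast
    rw [mul_comm, ← nsmul_eq_mul]
    exact Finset.card_nsmul_le_sum _ _ _ fun v hv => (Finset.mem_filter.mp hv).2.2
  have h4 : ((H ∪ S).card : ℝ) ≤ H.card + S.card := by exact_mod_cast Finset.card_union_le _ _
  nlinarith

end Arboricity

/-! ### The primal-dual process, independent of its distributed implementation. -/

section PrimalDual

variable {V : Type*} [Fintype V] [DecidableEq V]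

/-- The neighbors of `v` whose load is still below the threshold `1 - 2 * δ`. -/
noncomputable def liveNbrs (G : SimpleGraph V) [DecidableRel G.Adj] (δ : ℝ) (y : V → ℝ) (v : V) : Finset V :=
  {u ∈ G.neighborFinset v | y u < 1 - 2 * δ}

/-- `y i v` is the load of `v` after `i` iterations of the primal-dual process with threshold
degree `D` and step `δ`, and `g i v` is the set of neighbors whose requests are granted by `v` in
iteration `i`. -/
structure IsRun (G : SimpleGraph V) [DecidableRel G.Adj] (D δ : ℝ) (y : ℕ → V → ℝ)
    (g : ℕ → V → Finset V) : Prop where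
  init : ∀ v, y 0 v = if D ≤ G.degree v then 1 else 0
  grant_subset : ∀ i v, y i v < 1 - 2 * δ → g i v ⊆ liveNbrs G δ (y i) v
  grant_le : ∀ i v, y i v < 1 - 2 * δ →
    ∑ u ∈ g i v, δ / (liveNbrs G δ (y i) u).card ≤ 1 - δ - y i v
  grant_maximal : ∀ i v, y i v < 1 - 2 * δ → g i v = liveNbrs G δ (y i) v ∨
    1 - δ - y i v - δ < ∑ u ∈ g i v, δ / (liveNbrs G δ (y i) u).card
  step : ∀ i v, y (i + 1) v = if y i v < 1 - 2 * δ then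
      y i v + ∑ u ∈ g i v, δ / (liveNbrs G δ (y i) u).card +
        ∑ u ∈ liveNbrs G δ (y i) v with v ∈ g i u, δ / (liveNbrs G δ (y i) v).card
    else y i v

namespace IsRun

variable {G : SimpleGraph V} [DecidableRel G.Adj] {D δ : ℝ} {y : ℕ → V → ℝ}
  {g : ℕ → V → Finset V}

theorem le_succ (h : IsRun G D δ y g) (hδ : 0 < δ) (i : ℕ) (v : V) : y i v ≤ y (i + 1) v := by
  rw [h.step]
  split_ifs
  · have h1 : 0 ≤ ∑ u ∈ g i v, δ / ((liveNbrs G δ (y i) u).card : ℝ) :=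
      Finset.sum_nonneg fun _ _ => by positivity
    have h2 : 0 ≤ ∑ u ∈ liveNbrs G δ (y i) v with v ∈ g i u,
        δ / ((liveNbrs G δ (y i) v).card : ℝ) :=
      Finset.sum_nonneg fun _ _ => by positivity
    linarith
  · exact le_rfl

theorem monotone (h : IsRun G D δ y g) (hδ : 0 < δ) (v : V) : Monotone fun i => y i v :=
  monotone_nat_of_le_succ fun i => h.le_succ hδ i v

theorem le_one (h : IsRun G D δ y g) (hδ : 0 < δ) (i : ℕ) (v : V) : y i v ≤ 1 := by
  induction i with
  | zero => rw [h.init]; split_ifs <;> norm_num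
  | succ i ih =>
    rw [h.step]
    split_ifs with hv
    -- Grants stop at load `1 - δ`; the reserved `δ` pays for the vertex's own accepted requests.
    · have h1 := h.grant_le i v hv
      have h2 : ∑ u ∈ liveNbrs G δ (y i) v with v ∈ g i u,
          δ / ((liveNbrs G δ (y i) v).card : ℝ) ≤ δ := by
        rw [Finset.sum_const, nsmul_eq_mul]
        rcases Nat.eq_zero_or_pos (liveNbrs G δ (y i) v).card with h0 | h0
        · rw [h0]; simp [hδ.le]
        · rw [mul_div_assoc', div_le_iff₀ (by exact_mod_cast h0), mul_comm]
          gcongr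
          exact Finset.filter_subset _ _
      linarith
    · exact ih

theorem degree_lt_of_live (h : IsRun G D δ y g) (hδ : 0 < δ) {i : ℕ} {v : V}
    (hv : y i v < 1 - 2 * δ) : (G.degree v : ℝ) < D := by
  by_contra! hD
  have h1 := h.monotone hδ v (Nat.zero_le i)
  simp only [h.init, if_pos hD] at h1
  linarith

/-- Each accepted request becomes weight on its edge and is charged to both ends. High-degree
vertices start at load `1`, so they are never live and carry no weight. -/
theorem exists_fractionalMatching (h : IsRun G D δ y g) (hδ : 0 < δ) (i : ℕ) :
    ∃ X : V → V → ℝ, (∀ u v, X u v = X v u) ∧ (∀ u v, 0 ≤ X u v) ∧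
      (∀ u v, X u v ≠ 0 → G.Adj u v ∧ (G.degree u : ℝ) < D) ∧
      ∀ v, (G.degree v : ℝ) < D → ∑ u, X v u = y i v := by
  induction i with
  | zero =>
    refine ⟨fun _ _ => 0, by simp, by simp, by simp, ?_⟩
    intro v hv
    simp [h.init, hv]
  | succ i ih =>
    obtain ⟨X, hsymm, hnn, hsupp, hsum⟩ := ih
    let c : V → ℝ := fun u => δ / ((liveNbrs G δ (y i) u).card : ℝ)
    have hc : ∀ u, 0 ≤ c u := fun u => by positivity
    let I : V → V → ℝ := fun v u =>
      if (y i v < 1 - 2 * δ ∧ y i u < 1 - 2 * δ) ∧ G.Adj v u then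
        (if u ∈ g i v then c u else 0) + (if v ∈ g i u then c v else 0) else 0
    refine ⟨fun v u => X v u + I v u, ?_, ?_, ?_, ?_⟩
    · intro u v
      simp only [I]
      rw [hsymm u v]
      congr 1
      exact if_congr (by rw [G.adj_comm u v]; tauto) (add_comm _ _) rfl
    · intro u v
      have : 0 ≤ I u v := by
        simp only [I]
        split_ifs <;> simp [hc, add_nonneg]
      exact add_nonneg (hnn u v) this
    · intro u v huv
      by_cases hX : X u v = 0
      · have hI : I u v ≠ 0 := by simpa [hX] using huv
        have hcond : (y i u < 1 - 2 * δ ∧ y i v < 1 - 2 * δ) ∧ G.Adj u v := by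
          by_contra hcon
          exact hI (if_neg hcon)
        exact ⟨hcond.2, h.degree_lt_of_live hδ hcond.1.1⟩
      · exact hsupp u v hX
    · intro v hv
      rw [Finset.sum_add_distrib, hsum v hv, h.step]
      split_ifs with hlive
      · rw [add_assoc]
        congr 1
        have hI : ∀ u, I v u = (if u ∈ g i v then c u else 0) +
            (if u ∈ liveNbrs G δ (y i) v ∧ v ∈ g i u then c v else 0) := by
          intro u
          by_cases hu : u ∈ liveNbrs G δ (y i) v
          · have hu' := hu
            simp only [liveNbrs, mem_filter, SimpleGraph.mem_neighborFinset] at hu'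
            simp [I, hlive, hu, hu'.1, hu'.2]
          · have hg : u ∉ g i v := fun hg => hu (h.grant_subset i v hlive hg)
            have hu' : ¬ (y i u < 1 - 2 * δ ∧ G.Adj v u) := by
              simp only [liveNbrs, mem_filter, SimpleGraph.mem_neighborFinset] at hu
              tauto
            simp only [I, hg, hu, hlive, true_and, if_neg hu', if_false, false_and, add_zero]
        rw [Finset.sum_congr rfl fun u _ => hI u, Finset.sum_add_distrib]
        congr 1
        · rw [← Finset.sum_filter]
          simp [c]
        · rw [← Finset.sum_filter]
          refine Finset.sum_congr ?_ fun _ _ => rfl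
          ext u
          simp
      · rw [Finset.sum_eq_zero, add_zero]
        intro u _
        simp [I, hlive]

/-- Weak duality: every edge of positive weight has an end in `S` of low degree, each such end has
load at most `1`, and each edge is counted from both sides. -/
theorem sum_load_le (h : IsRun G D δ y g) (hδ : 0 < δ) (i : ℕ) (S : Finset V)
    (hS : G.IsVertexCover (S : Set V)) :
    ∑ v with (G.degree v : ℝ) < D, y i v ≤ 2 * (({v ∈ S | (G.degree v : ℝ) < D}).card : ℝ) := by
  obtain ⟨X, hsymm, hnn, hsupp, hsum⟩ := h.exists_fractionalMatching hδ i
  set L : Finset V := {v ∈ S | (G.degree v : ℝ) < D}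
  have hL : ∑ v ∈ L, ∑ u, X v u ≤ L.card := by
    rw [← nsmul_one, ← Finset.sum_const]
    refine Finset.sum_le_sum fun v hv => ?_
    rw [hsum v (Finset.mem_filter.mp hv).2]
    exact h.le_one hδ i v
  calc ∑ v with (G.degree v : ℝ) < D, y i v
      = ∑ v with (G.degree v : ℝ) < D, ∑ u, X v u :=
        Finset.sum_congr rfl fun v hv => (hsum v (Finset.mem_filter.mp hv).2).symm
    _ ≤ ∑ v, ∑ u, X v u :=
        Finset.sum_le_sum_of_subset_of_nonneg (Finset.subset_univ _) fun v _ _ =>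
          Finset.sum_nonneg fun u _ => hnn v u
    _ ≤ ∑ v, ∑ u, ((if v ∈ L then X v u else 0) + (if u ∈ L then X v u else 0)) := by
        refine Finset.sum_le_sum fun v _ => Finset.sum_le_sum fun u _ => ?_
        by_cases hX : X v u = 0
        · simp [hX]
        · have h1 := hsupp v u hX
          have h2 := hsupp u v (by rwa [hsymm])
          have h3 := hnn v u
          rcases hS h1.1 with hv | hu
          · have : v ∈ L := Finset.mem_filter.mpr ⟨hv, h1.2⟩
            rw [if_pos this]
            split_ifs <;> linarith
          · have : u ∈ L := Finset.mem_filter.mpr ⟨hu, h2.2⟩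
            rw [if_pos this]
            split_ifs <;> linarith
    _ = ∑ v ∈ L, ∑ u, X v u + ∑ v ∈ L, ∑ u, X v u := by
        simp only [Finset.sum_add_distrib]
        have h1 : ∀ a : V, ∑ b, (if a ∈ L then X a b else 0) =
            if a ∈ L then ∑ b, X a b else 0 := fun a => by split_ifs <;> simp
        have h2 : ∑ a, ∑ b, (if b ∈ L then X a b else 0) =
            ∑ a, ∑ b, (if a ∈ L then X a b else 0) := by
          rw [Finset.sum_comm]
          simp only [hsymm]
        rw [h2]
        simp only [h1, Finset.sum_ite_mem, Finset.univ_inter]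
    _ ≤ 2 * (L.card : ℝ) := by linarith

/-- A vertex that stays live spends on every neighbor that stays live. -/
theorem add_div_le_succ (h : IsRun G D δ y g) (hδ : 0 < δ) (i : ℕ) (v : V)
    (hv : y i v < 1 - 2 * δ) :
    y i v + δ * ((liveNbrs G δ (y (i + 1)) v).card / (liveNbrs G δ (y i) v).card) ≤
      y (i + 1) v := by
  have hsub : liveNbrs G δ (y (i + 1)) v ⊆ {u ∈ liveNbrs G δ (y i) v | v ∈ g i u} := by
    intro u hu
    simp only [liveNbrs, mem_filter, SimpleGraph.mem_neighborFinset] at hu ⊢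
    have hu' : y i u < 1 - 2 * δ := (h.le_succ hδ i u).trans_lt hu.2
    refine ⟨⟨hu.1, hu'⟩, ?_⟩
    rcases h.grant_maximal i u hu' with h1 | h1
    · rw [h1]
      simp [liveNbrs, hv, hu.1.symm]
    -- If `u` refused a request, maximality would push its load above `1 - 2 * δ`, and it would no
    -- longer be live.
    · have h2 := hu.2
      rw [h.step, if_pos hu'] at h2
      have h3 : 0 ≤ ∑ w ∈ liveNbrs G δ (y i) u with u ∈ g i w,
          δ / ((liveNbrs G δ (y i) u).card : ℝ) :=
        Finset.sum_nonneg fun _ _ => by positivity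
      linarith
  have h1 : 0 ≤ ∑ u ∈ g i v, δ / ((liveNbrs G δ (y i) u).card : ℝ) :=
    Finset.sum_nonneg fun _ _ => by positivity
  have h2 : δ * (((liveNbrs G δ (y (i + 1)) v).card : ℝ) / (liveNbrs G δ (y i) v).card) ≤
      ∑ u ∈ liveNbrs G δ (y i) v with v ∈ g i u, δ / ((liveNbrs G δ (y i) v).card : ℝ) := by
    rw [Finset.sum_const, nsmul_eq_mul, mul_div_assoc', mul_div_assoc', mul_comm δ]
    gcongr
  rw [h.step, if_pos hv]
  linarith

theorem isVertexCover (h : IsRun G D δ y g) (hδ : 0 < δ) {T : ℕ} (hT : 0 < T)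
    (hTD : 1 / δ ≤ T * Real.exp (-(Real.log D / T))) :
    G.IsVertexCover {v | 1 - 2 * δ ≤ y T v} := by
  intro a b hab
  by_contra! hcon
  simp only [Set.mem_ofPred_eq, not_le] at hcon
  obtain ⟨ha, hb⟩ := hcon
  set d : ℕ → ℕ := fun i => (liveNbrs G δ (y i) a).card with hd
  have hlive : ∀ i ≤ T, ∀ v, y T v < 1 - 2 * δ → y i v < 1 - 2 * δ := fun i hi v hv =>
    (h.monotone hδ v hi).trans_lt hv
  have hdpos : ∀ i ≤ T, 0 < d i := fun i hi =>
    Finset.card_pos.mpr ⟨b, by simp [liveNbrs, hab, hlive i hi b hb]⟩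
  set l : ℝ := Real.log D / T with hl
  -- AM-GM in telescoping form: `log z ≤ z - 1` at `z = r * exp l` gives `r ≥ exp (-l) * (1 + l +
  -- log r)` for each ratio `r = d (i + 1) / d i`. The choice `l = log D / T` makes `T * l` absorb
  -- `log (d 0)`.
  have key : ∀ i ≤ T, δ * Real.exp (-l) * (i * (1 + l) + (Real.log (d i) - Real.log (d 0))) ≤
      y i a := by
    intro i
    induction i with
    | zero =>
      intro _
      rw [h.init]
      split_ifs <;> simp
    | succ i ih =>
      intro hi
      have ih := ih (by omega)
      have h1 := h.add_div_le_succ hδ i a (hlive i (by omega) a ha)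
      have hp1 : (0 : ℝ) < d i := by exact_mod_cast hdpos i (by omega)
      have hp2 : (0 : ℝ) < d (i + 1) := by exact_mod_cast hdpos (i + 1) hi
      have h2 := Real.log_le_sub_one_of_pos (x := (d (i + 1) / d i : ℝ) * Real.exp l)
        (by positivity)
      rw [Real.log_mul (by positivity) (by positivity), Real.log_exp,
        Real.log_div hp2.ne' hp1.ne'] at h2
      have h3 : Real.exp (-l) * (1 + l + (Real.log (d (i + 1)) - Real.log (d i))) ≤
          (d (i + 1) / d i : ℝ) := by
        calc _ ≤ Real.exp (-l) * ((d (i + 1) / d i : ℝ) * Real.exp l) := by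
              gcongr; linarith
          _ = (d (i + 1) / d i : ℝ) * (Real.exp (-l) * Real.exp l) := by ring
          _ = _ := by rw [← Real.exp_add]; simp
      have h4 := mul_le_mul_of_nonneg_left h3 hδ.le
      push_cast
      simp only [hd] at *
      linarith
  have hfin := key T le_rfl
  have hTpos : (0 : ℝ) < T := by exact_mod_cast hT
  have hd0 : Real.log (d 0) ≤ Real.log D := by
    refine Real.log_le_log (by exact_mod_cast hdpos 0 (by omega)) ?_
    have h1 : d 0 ≤ G.degree a := Finset.card_le_card (Finset.filter_subset _ _)
    exact (Nat.cast_le.mpr h1).trans (h.degree_lt_of_live hδ ha).le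
  have hdT : 0 ≤ Real.log (d T) :=
    Real.log_nonneg (by exact_mod_cast hdpos T le_rfl)
  have hTl : T * l = Real.log D := by rw [hl]; field_simp
  have h5 : δ * Real.exp (-l) * T ≤ y T a := by
    refine le_trans ?_ hfin
    gcongr
    linarith
  have h6 : 1 ≤ δ * Real.exp (-l) * T := by
    rw [div_le_iff₀ hδ] at hTD
    linarith
  linarith

/-- The output splits into low-degree vertices `M`, paid for by `L`, high-degree vertices `R` of
`S`, and high-degree vertices `H` outside `S`, paid for by sparsity. -/
theorem card_le (h : IsRun G D δ y g) (hδ : 0 < δ) (hδ' : 2 * δ < 1) {α ε : ℝ}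
    (hα : 1 ≤ α) (hε : 0 < ε) (hDε : D = α + 2 * α / ε) (hδε : 2 / (1 - 2 * δ) ≤ 2 + ε / 2)
    (hG : (arboricity G : ℝ) ≤ α) (T : ℕ) (S : Finset V) (hS : G.IsVertexCover (S : Set V)) :
    (({v | 1 - 2 * δ ≤ y T v} : Finset V).card : ℝ) ≤ (2 + ε) * S.card := by
  set L : Finset V := {v ∈ S | (G.degree v : ℝ) < D}
  set R : Finset V := {v ∈ S | ¬ (G.degree v : ℝ) < D}
  set H : Finset V := {v | v ∉ S ∧ D ≤ G.degree v}
  set M : Finset V := {v | (G.degree v : ℝ) < D ∧ 1 - 2 * δ ≤ y T v}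
  have hLR : (L.card : ℝ) + R.card = S.card := by
    exact_mod_cast Finset.card_filter_add_card_filter_not (s := S) fun v => (G.degree v : ℝ) < D
  have hH : (H.card : ℝ) ≤ ε / 2 * S.card := by
    have h1 := card_high_degree_le (D := D) (by linarith) hG S hS
    have h2 : D - α = α * (2 / ε) := by rw [hDε]; ring
    rw [h2, mul_assoc] at h1
    have h3 := le_of_mul_le_mul_left h1 (by linarith)
    calc (H.card : ℝ) = ε / 2 * (2 / ε * H.card) := by field_simp
      _ ≤ _ := by gcongr
  have hM : (M.card : ℝ) ≤ (2 + ε / 2) * L.card := by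
    have h1 : (1 - 2 * δ) * M.card ≤ 2 * L.card := by
      refine le_trans ?_ (h.sum_load_le hδ T S hS)
      calc (1 - 2 * δ) * M.card = ∑ v ∈ M, (1 - 2 * δ) := by
            rw [Finset.sum_const, nsmul_eq_mul, mul_comm]
        _ ≤ ∑ v ∈ M, y T v := Finset.sum_le_sum fun v hv => (Finset.mem_filter.mp hv).2.2
        _ ≤ _ := by
            refine Finset.sum_le_sum_of_subset_of_nonneg ?_ ?_
            · intro v hv
              simpa using (Finset.mem_filter.mp hv).2.1
            · intro v _ _
              refine le_trans ?_ (h.monotone hδ v (Nat.zero_le T))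
              simp only [h.init]
              split_ifs <;> norm_num
    calc (M.card : ℝ) ≤ 2 * L.card / (1 - 2 * δ) := by
          rw [le_div_iff₀ (by linarith)]; linarith
      _ = 2 / (1 - 2 * δ) * L.card := by ring
      _ ≤ _ := by gcongr
  have hcard : (({v | 1 - 2 * δ ≤ y T v} : Finset V).card : ℝ) ≤ M.card + (R.card + H.card) := by
    have hsub : ({v | 1 - 2 * δ ≤ y T v} : Finset V) ⊆ M ∪ (R ∪ H) := by
      intro v hv
      have hv := (Finset.mem_filter.mp hv).2
      simp only [M, R, H, mem_union, mem_filter, mem_univ, true_and, not_lt]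
      by_cases h1 : v ∈ S <;> by_cases h2 : (G.degree v : ℝ) < D <;>
        simp [h1, h2, hv, not_lt.mp]
    have h1 := (Finset.card_le_card hsub).trans ((Finset.card_union_le _ _).trans
      (Nat.add_le_add_left (Finset.card_union_le _ _) _))
    exact_mod_cast h1
  have hL0 : (0 : ℝ) ≤ L.card := by positivity
  have hR0 : (0 : ℝ) ≤ R.card := by positivity
  have : 0 ≤ ε * R.card := by positivity
  nlinarith

end IsRun

end PrimalDual

/-! ### Choosing which requests to grant. -/

section Selection

/-- `t` is a subset of `s` of total at most `c` that is all of `s` or comes within `δ` of `c`. -/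
def IsMaximalSelection {ι : Type*} (s : Finset ι) (r : ι → ℝ) (δ c : ℝ) (t : Finset ι) : Prop :=
  t ⊆ s ∧ ∑ i ∈ t, r i ≤ c ∧ (t = s ∨ c - δ < ∑ i ∈ t, r i)

theorem exists_isMaximalSelection {ι : Type*} (s : Finset ι) (r : ι → ℝ) {δ c : ℝ} (hc : 0 ≤ c)
    (hr : ∀ i ∈ s, r i ≤ δ) : ∃ t, IsMaximalSelection s r δ c t := by
  classical
  induction s using Finset.induction_on with
  | empty => exact ⟨∅, by simp [IsMaximalSelection, hc]⟩
  | insert a s ha ih =>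
    obtain ⟨t, hts, htc, ht⟩ := ih fun i hi => hr i (Finset.mem_insert_of_mem hi)
    rcases ht with rfl | ht
    · by_cases hle : ∑ i ∈ insert a t, r i ≤ c
      · exact ⟨insert a t, Finset.Subset.refl _, hle, Or.inl rfl⟩
      -- The first item that does not fit is at most `δ`, so the total is already within `δ` of the
      -- capacity.
      · refine ⟨t, Finset.subset_insert _ _, htc, Or.inr ?_⟩
        rw [Finset.sum_insert ha, not_le] at hle
        linarith [hr a (Finset.mem_insert_self _ _)]
    · exact ⟨t, hts.trans (Finset.subset_insert _ _), htc, Or.inr ht⟩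

open Classical in
/-- Some set with `IsMaximalSelection`, if there is one. -/
noncomputable def maximalSelection {ι : Type*} (s : Finset ι) (r : ι → ℝ) (δ c : ℝ) : Finset ι :=
  if h : ∃ t, IsMaximalSelection s r δ c t then h.choose else ∅

theorem isMaximalSelection_maximalSelection {ι : Type*} (s : Finset ι) (r : ι → ℝ) {δ c : ℝ}
    (hc : 0 ≤ c) (hr : ∀ i ∈ s, r i ≤ δ) :
    IsMaximalSelection s r δ c (maximalSelection s r δ c) := by
  have h := exists_isMaximalSelection s r hc hr
  rw [maximalSelection, dif_pos h]
  exact h.choose_spec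

end Selection

/-! ### The message-passing algorithm, its message size, and its simulation of the process. -/

/-- The number with the given binary digits, least significant first. -/
def decodeBits (m : Message) : ℕ := m.foldr Nat.bit 0

theorem decodeBits_bits (n : ℕ) : decodeBits n.bits = n := by
  induction n using Nat.binaryRec' with
  | zero => simp [decodeBits]
  | bit b n h ih =>
    rw [Nat.bits_append_bit _ _ h]
    simpa [decodeBits] using congrArg (Nat.bit b) ih

/-- The local state: the phase within the current iteration, the load, the ports that lead to live
neighbors, and the requests received through the ports. -/
structure VertexState (d : ℕ) where
  phase : Fin 3
  load : ℝ
  live : Finset (Fin d)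
  request : Fin d → ℝ

/-- The ports whose requests are granted. -/
noncomputable def VertexState.granted {d : ℕ} (δ : ℝ) (s : VertexState d) : Finset (Fin d) :=
  maximalSelection s.live s.request δ (1 - δ - s.load)

/-- Vertices of degree at least `D` join the cover at once. An iteration of the others has three
rounds: they announce whether their load is below `1 - 2 * δ`; they announce the number `k` of
their live neighbors, and thereby request `δ / k` from each of them; and they announce which
requests they grant. -/
noncomputable def coverAlgorithm (D δ : ℝ) (T : ℕ) : Algorithm where
  State := VertexState
  start d _ := ⟨0, if D ≤ d then 1 else 0, ∅, 0⟩
  send s p := match s.phase with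
    | 0 => [decide (s.load < 1 - 2 * δ)]
    | 1 => s.live.card.bits
    | 2 => [decide (p ∈ s.granted δ)]
  receive s m := match s.phase with
    | 0 => ⟨1, s.load, {p | m p = [true]}, 0⟩
    | 1 => ⟨2, s.load, s.live, fun p => δ / decodeBits (m p)⟩
    | 2 => ⟨0, if s.load < 1 - 2 * δ then
          s.load + ∑ p ∈ s.granted δ, s.request p +
            ∑ p ∈ s.live with m p = [true], δ / s.live.card
        else s.load, ∅, 0⟩
  rounds := 3 * T
  output s := decide (1 - 2 * δ ≤ s.load)

namespace coverAlgorithm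

variable {V : Type*} [Fintype V] {G : SimpleGraph V} [DecidableRel G.Adj] {D δ : ℝ} {T : ℕ}

theorem length_send_le {d : ℕ} (hd : 0 < d) (s : VertexState d) (p : Fin d) :
    ((coverAlgorithm D δ T).send s p).length ≤ d.size := by
  have h1 : 1 ≤ d.size := Nat.size_pos.mpr hd
  have h2 : s.live.card.size ≤ d.size :=
    Nat.size_le_size ((Finset.card_le_univ _).trans (by simp))
  obtain ⟨ph, y, l, r⟩ := s
  fin_cases ph
  · exact h1
  · simpa [coverAlgorithm, ← Nat.size_eq_bits_len] using h2
  · exact h1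

/-- Here `size ≤ 1 + log n / log 2 ≤ 2 log n / log 2`, because `n ≥ 2`, and `2 / log 2 < 4`. -/
theorem size_le_mul_log {d n : ℕ} (hd : 0 < d) (hdn : d < n) :
    (d.size : ℝ) ≤ 4 * Real.log n := by
  have h2 : 2 ^ (d.size - 1) ≤ d := Nat.lt_size.mp (by
    have := Nat.size_pos.mpr hd
    omega)
  have h3 : ((2 : ℝ) ^ (d.size - 1)) ≤ n := by exact_mod_cast h2.trans hdn.le
  have h4 := Real.log_le_log (by positivity) h3
  rw [Real.log_pow] at h4
  have h5 : Real.log 2 ≤ Real.log n :=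
    Real.log_le_log (by norm_num) (by exact_mod_cast (by omega : 2 ≤ n))
  have h6 := Real.log_two_gt_d9
  have h7 : ((d.size - 1 : ℕ) : ℝ) = d.size - 1 := by
    rw [Nat.cast_sub (Nat.size_pos.mpr hd)]; simp
  rw [h7] at h4
  have h8 : (1 : ℝ) ≤ d.size := by exact_mod_cast Nat.size_pos.mpr hd
  nlinarith

theorem messagesBoundedBy (N : Network G) :
    (coverAlgorithm D δ T).MessagesBoundedBy N (4 * Real.log (Fintype.card V)) := by
  intro t _ v p
  have hd : 0 < G.degree v := p.pos
  exact (Nat.cast_le.mpr (length_send_le hd _ p)).trans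
    (size_le_mul_log hd (G.degree_lt_card_verts v))

/-- The load of a vertex after `i` iterations. -/
noncomputable def load (D δ : ℝ) (T : ℕ) (N : Network G) (i : ℕ) (v : V) : ℝ :=
  ((coverAlgorithm D δ T).stateAfter N (3 * i) v).load

theorem phase_stateAfter (N : Network G) (i : ℕ) (v : V) :
    ((coverAlgorithm D δ T).stateAfter N (3 * i) v).phase = 0 := by
  induction i generalizing v with
  | zero => rfl
  | succ i ih =>
    rw [show 3 * (i + 1) = 3 * i + 1 + 1 + 1 by ring]
    simp [Algorithm.stateAfter, coverAlgorithm, ih] at ih ⊢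

theorem stateAfter_add_one (N : Network G) (i : ℕ) (v : V) :
    (coverAlgorithm D δ T).stateAfter N (3 * i + 1) v =
      ⟨1, load D δ T N i v, {p | load D δ T N i (N.nbr v p) < 1 - 2 * δ}, 0⟩ := by
  have h := fun v => phase_stateAfter (D := D) (δ := δ) (T := T) N i v
  have hs : ∀ p, (coverAlgorithm D δ T).send
      ((coverAlgorithm D δ T).stateAfter N (3 * i) (N.nbr v p)) (N.backPort v p) =
      [decide (load D δ T N i (N.nbr v p) < 1 - 2 * δ)] := by
    intro p
    have h' := h (N.nbr v p)
    unfold load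
    generalize (coverAlgorithm D δ T).stateAfter N (3 * i) (N.nbr v p) = s at h' ⊢
    obtain ⟨ph, a, b, c⟩ := s
    subst h'
    rfl
  have hr : ∀ (s : VertexState (G.degree v)) (m : Fin (G.degree v) → Message), s.phase = 0 →
      (coverAlgorithm D δ T).receive s m = ⟨1, s.load, {p | m p = [true]}, 0⟩ := by
    rintro ⟨_, a, b, c⟩ m rfl
    rfl
  rw [Algorithm.stateAfter, hr _ _ (h v)]
  simp only [hs]
  refine congrArg (fun l => VertexState.mk 1 (load D δ T N i v) l 0) ?_
  ext p
  simp only [mem_filter, mem_univ, true_and, List.cons.injEq, and_true, decide_eq_true_eq]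

theorem selected_eq (N : Network G) :
    (coverAlgorithm D δ T).selected N = {v | 1 - 2 * δ ≤ load D δ T N T v} := by
  ext v
  simp [Algorithm.selected, load, coverAlgorithm]

/-- The neighbors whose requests are granted in iteration `i`. -/
noncomputable def grantees [DecidableEq V] (D δ : ℝ) (T : ℕ) (N : Network G) (i : ℕ) (v : V) :
    Finset V :=
  (((coverAlgorithm D δ T).stateAfter N (3 * i + 2) v).granted δ).image (N.nbr v)

end coverAlgorithm

namespace Network

variable {V : Type*} [Fintype V] {G : SimpleGraph V} [DecidableRel G.Adj]

theorem adj_nbr (N : Network G) (v : V) (p : Fin (G.degree v)) : G.Adj v (N.nbr v p) :=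
  (N.port v p).2

theorem nbr_injective (N : Network G) (v : V) : Function.Injective (N.nbr v) :=
  fun _ _ h => (N.port v).injective (Subtype.ext h)

theorem exists_nbr_eq (N : Network G) {v u : V} (h : G.Adj v u) : ∃ p, N.nbr v p = u :=
  ⟨(N.port v).symm ⟨u, h⟩, by simp [nbr]⟩

theorem nbr_backPort (N : Network G) (v : V) (p : Fin (G.degree v)) :
    N.nbr (N.nbr v p) (N.backPort v p) = v := by
  exact congrArg Subtype.val ((N.port (N.nbr v p)).apply_symm_apply _)

end Network

namespace coverAlgorithm

variable {V : Type*} [Fintype V] [DecidableEq V] {G : SimpleGraph V} [DecidableRel G.Adj]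
  {D δ : ℝ} {T : ℕ}

theorem image_nbr_live (N : Network G) (y : V → ℝ) (v : V) :
    ({p | y (N.nbr v p) < 1 - 2 * δ} : Finset (Fin (G.degree v))).image (N.nbr v) =
      liveNbrs G δ y v := by
  ext u
  simp only [mem_image, mem_filter, mem_univ, true_and, liveNbrs,
    SimpleGraph.mem_neighborFinset]
  constructor
  · rintro ⟨p, hp, rfl⟩
    exact ⟨N.adj_nbr v p, hp⟩
  · rintro ⟨h1, h2⟩
    obtain ⟨p, rfl⟩ := N.exists_nbr_eq h1
    exact ⟨p, h2, rfl⟩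

theorem card_live (N : Network G) (y : V → ℝ) (v : V) :
    ({p | y (N.nbr v p) < 1 - 2 * δ} : Finset (Fin (G.degree v))).card =
      (liveNbrs G δ y v).card := by
  rw [← image_nbr_live N, Finset.card_image_of_injective _ (N.nbr_injective v)]

theorem stateAfter_add_two (N : Network G) (i : ℕ) (v : V) :
    (coverAlgorithm D δ T).stateAfter N (3 * i + 2) v =
      ⟨2, load D δ T N i v, {p | load D δ T N i (N.nbr v p) < 1 - 2 * δ},
        fun p => δ / (liveNbrs G δ (load D δ T N i) (N.nbr v p)).card⟩ := by
  rw [Algorithm.stateAfter]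
  simp only [stateAfter_add_one]
  simp [coverAlgorithm, decodeBits_bits, card_live]

theorem load_succ (N : Network G) (i : ℕ) (v : V) :
    load D δ T N (i + 1) v = if load D δ T N i v < 1 - 2 * δ then
      load D δ T N i v +
        ∑ u ∈ grantees D δ T N i v, δ / (liveNbrs G δ (load D δ T N i) u).card +
        ∑ u ∈ liveNbrs G δ (load D δ T N i) v with v ∈ grantees D δ T N i u,
          δ / (liveNbrs G δ (load D δ T N i) v).card
    else load D δ T N i v := by
  have hs : ∀ p, (coverAlgorithm D δ T).send
      ((coverAlgorithm D δ T).stateAfter N (3 * i + 2) (N.nbr v p)) (N.backPort v p) =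
      [decide (v ∈ grantees D δ T N i (N.nbr v p))] := by
    intro p
    have : v ∈ grantees D δ T N i (N.nbr v p) ↔ N.backPort v p ∈
        ((coverAlgorithm D δ T).stateAfter N (3 * i + 2) (N.nbr v p)).granted δ := by
      rw [grantees, ← (N.nbr_injective (N.nbr v p)).mem_finset_image, N.nbr_backPort]
    simp only [this]
    rw [stateAfter_add_two]
    rfl
  have h0 : load D δ T N (i + 1) v =
      ((coverAlgorithm D δ T).stateAfter N (3 * i + 2 + 1) v).load := rfl
  rw [h0, Algorithm.stateAfter]
  simp only [hs]
  rw [grantees, Finset.sum_image (N.nbr_injective v).injOn, ← image_nbr_live N,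
    Finset.filter_image, Finset.sum_image (N.nbr_injective v).injOn]
  rw [image_nbr_live N, stateAfter_add_two]
  simp [coverAlgorithm, card_live]

theorem isRun (hδ : 0 < δ) (N : Network G) :
    IsRun G D δ (load D δ T N) (grantees D δ T N) := by
  have hsel : ∀ i v, load D δ T N i v < 1 - 2 * δ →
      IsMaximalSelection (liveNbrs G δ (load D δ T N i) v)
        (fun u => δ / (liveNbrs G δ (load D δ T N i) u).card) δ (1 - δ - load D δ T N i v)
        (grantees D δ T N i v) := by
    intro i v hv
    have h1 : IsMaximalSelection
        ({p | load D δ T N i (N.nbr v p) < 1 - 2 * δ} : Finset (Fin (G.degree v)))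
        (fun p => δ / (liveNbrs G δ (load D δ T N i) (N.nbr v p)).card) δ
        (1 - δ - load D δ T N i v)
        (((coverAlgorithm D δ T).stateAfter N (3 * i + 2) v).granted δ) := by
      rw [stateAfter_add_two]
      refine isMaximalSelection_maximalSelection _ _ (by linarith) fun p hp => ?_
      -- The live vertex `v` is itself counted by its neighbor, so the requested fraction is at most
      -- `δ`.
      have hpos : 0 < (liveNbrs G δ (load D δ T N i) (N.nbr v p)).card :=
        Finset.card_pos.mpr ⟨v, by simp [liveNbrs, hv, (N.adj_nbr v p).symm]⟩
      exact div_le_self hδ.le (by exact_mod_cast hpos)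
    obtain ⟨h2, h3, h4⟩ := h1
    have hsum := Finset.sum_image
      (s := ((coverAlgorithm D δ T).stateAfter N (3 * i + 2) v).granted δ)
      (f := fun u => δ / ((liveNbrs G δ (load D δ T N i) u).card : ℝ))
      (N.nbr_injective v).injOn
    refine ⟨?_, ?_, ?_⟩
    · rw [← image_nbr_live N]
      exact Finset.image_subset_image h2
    · rw [grantees, hsum]
      exact h3
    · rw [grantees, hsum]
      refine h4.imp (fun h => ?_) id
      rw [h, image_nbr_live]
  refine ⟨fun v => rfl, fun i v hv => (hsel i v hv).1, fun i v hv => (hsel i v hv).2.1,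
    fun i v hv => (hsel i v hv).2.2, load_succ N⟩

theorem isApproxVertexCover {α ε : ℝ} (hα : 1 ≤ α) (hε : 0 < ε) (hG : (arboricity G : ℝ) ≤ α)
    (hδ : 0 < δ) (hδ' : 2 * δ < 1) (hδε : 2 / (1 - 2 * δ) ≤ 2 + ε / 2) (hT : 0 < T)
    (hTD : 1 / δ ≤ T * Real.exp (-(Real.log (α + 2 * α / ε) / T))) (N : Network G) :
    IsApproxVertexCover G (2 + ε) ((coverAlgorithm (α + 2 * α / ε) δ T).selected N) := by
  have hrun := isRun (D := α + 2 * α / ε) (T := T) hδ N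
  rw [selected_eq]
  refine ⟨hrun.isVertexCover hδ hT hTD, fun S' hS' => ?_⟩
  classical
  have h1 := hrun.card_le hδ hδ' hα hε rfl hδε hG T S'.toFinset (by simpa using hS')
  rw [← Set.ncard_coe_finset, ← Set.ncard_coe_finset] at h1
  simpa using h1

end coverAlgorithm

/-! ### The number of iterations and the final constants. -/

theorem one_div_le_iterations {E ε α q : ℝ} (hα : 1 ≤ α) (hε : 0 < ε) (hεE : ε ≤ E) {T : ℕ}
    (hq : q = Real.log (max (α / ε) 3) / (ε * Real.log (Real.log (max (α / ε) 3))))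
    (hT : (2 * (1 + Real.log (E + 2)) * E + 4 * (4 + E)) * q ≤ T) (hTpos : 0 < T) :
    1 / (ε / (2 * (4 + ε))) ≤ T * Real.exp (-(Real.log (α + 2 * α / ε) / T)) := by
  set x := max (α / ε) 3 with hx
  have hx3 : 3 ≤ x := le_max_right _ _
  have ht : 1 < Real.log x := by
    rw [Real.lt_log_iff_exp_lt (by linarith)]
    linarith [Real.exp_one_lt_d9]
  have hl : 0 < Real.log (Real.log x) := Real.log_pos ht
  set t := Real.log x with ht_def
  set l := Real.log t with hl_def
  have hE : 0 < E := hε.trans_le hεE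
  have hlE : 0 < Real.log (E + 2) := Real.log_pos (by linarith)
  set c := 1 + Real.log (E + 2)
  have hT' : (0 : ℝ) < T := by exact_mod_cast hTpos
  have hq0 : 0 < q := by rw [hq]; positivity
  have hqε : ε * l * q = t := by rw [hq]; field_simp
  have hD : Real.log (α + 2 * α / ε) ≤ c * t := by
    have h1 : α + 2 * α / ε ≤ (E + 2) * x := by
      calc α + 2 * α / ε = (ε + 2) * (α / ε) := by field_simp
        _ ≤ (E + 2) * x := by
            gcongr
            exact le_max_left _ _
    have h2 := Real.log_le_log (by positivity) h1
    rw [Real.log_mul (by positivity) (by positivity)] at h2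
    have : c * t = t + Real.log (E + 2) * t := by simp only [c]; ring
    nlinarith
  -- The first summand of the constant gives `D^(1/T) ≤ √t`; the second one then wins because `√t =
  -- exp (l / 2) ≥ l / 2`.
  have h1 : Real.log (α + 2 * α / ε) / T ≤ l / 2 := by
    rw [div_le_iff₀ hT']
    have h2 : c * t = l / 2 * (2 * c * ε * q) := by rw [← hqε]; ring
    refine hD.trans (h2.le.trans ?_)
    gcongr
    refine le_trans ?_ hT
    have h3 : 2 * c * ε ≤ 2 * c * E := by gcongr
    gcongr
    linarith
  have h2 : t * Real.exp (-(l / 2)) = Real.exp (l / 2) := by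
    rw [← Real.exp_log (show 0 < t by linarith), ← Real.exp_add, ← hl_def]
    congr 1
    ring
  have h3 : l / 2 ≤ Real.exp (l / 2) := by linarith [Real.add_one_le_exp (l / 2)]
  calc 1 / (ε / (2 * (4 + ε))) = 4 * (4 + ε) / (ε * l) * (l / 2) := by field_simp; ring
    _ ≤ 4 * (4 + E) / (ε * l) * Real.exp (l / 2) := by gcongr
    _ = 4 * (4 + E) * q * Real.exp (-(l / 2)) := by
        rw [← h2, ← hqε]; field_simp
    _ ≤ T * Real.exp (-(Real.log (α + 2 * α / ε) / T)) := by
        gcongr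
        refine le_trans ?_ hT
        gcongr
        have : 0 ≤ 2 * c * E := by positivity
        linarith

end DistVC

theorem mainTheorem6 :
    ∃ B : ℝ, ∀ E : ℝ, 0 < E → ∃ C : ℝ,
      ∀ α ε : ℝ, 1 ≤ α → 0 < ε → ε ≤ E →
        ∃ A : DistVC.Algorithm,
          (A.rounds : ℝ) ≤
            C * (Real.log (max (α / ε) 3) / (ε * Real.log (Real.log (max (α / ε) 3)))) ∧
          ∀ (V : Type*) [Fintype V] (G : SimpleGraph V) [DecidableRel G.Adj],
            (DistVC.arboricity G : ℝ) ≤ α →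
            ∀ N : DistVC.Network G,
              DistVC.IsApproxVertexCover G (2 + ε) (A.selected N) ∧
              A.MessagesBoundedBy N (B * Real.log (Fintype.card V)) := by
  -- The factor `3` counts the rounds per iteration; the last `E` absorbs the rounding up of `T`,
  -- since `1 ≤ E * q`.
  refine ⟨4, fun E hE => ⟨3 * (2 * (1 + Real.log (E + 2)) * E + 4 * (4 + E) + E), ?_⟩⟩
  intro α ε hα hε hεE
  set q := Real.log (max (α / ε) 3) / (ε * Real.log (Real.log (max (α / ε) 3))) with hq
  have hlE : 0 < Real.log (E + 2) := Real.log_pos (by linarith)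
  set C := 2 * (1 + Real.log (E + 2)) * E + 4 * (4 + E) with hC
  have hCpos : 0 < C := by positivity
  have ht : 1 < Real.log (max (α / ε) 3) := by
    rw [Real.lt_log_iff_exp_lt (by positivity)]
    linarith [Real.exp_one_lt_d9, le_max_right (α / ε) 3]
  have hl := Real.log_pos ht
  have hqE : 1 ≤ E * q := by
    have h1 := Real.log_le_sub_one_of_pos (zero_lt_one.trans ht)
    rw [hq, mul_div_assoc', le_div_iff₀ (by positivity), one_mul]
    exact mul_le_mul hεE (by linarith) hl.le hE.le
  have hqpos : 0 < q := by
    by_contra! h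
    nlinarith
  set T := ⌈C * q⌉₊
  have hTpos : 0 < T := Nat.ceil_pos.mpr (by positivity)
  -- This `δ` solves `2 / (1 - 2 * δ) = 2 + ε / 2`.
  refine ⟨DistVC.coverAlgorithm (α + 2 * α / ε) (ε / (2 * (4 + ε))) T, ?_, ?_⟩
  · have h1 : (T : ℝ) < C * q + 1 := Nat.ceil_lt_add_one (by positivity)
    have h2 : ((DistVC.coverAlgorithm (α + 2 * α / ε) (ε / (2 * (4 + ε))) T).rounds : ℝ) =
        3 * T := by simp [DistVC.coverAlgorithm]
    rw [h2]
    linarith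
  · intro V _ G _ hG N
    classical
    have h2δ : 1 - 2 * (ε / (2 * (4 + ε))) = 4 / (4 + ε) := by field_simp; ring
    refine ⟨DistVC.coverAlgorithm.isApproxVertexCover hα hε hG (by positivity) ?_ ?_ hTpos
      (DistVC.one_div_le_iterations hα hε hεE hq (Nat.le_ceil _) hTpos) N,
      DistVC.coverAlgorithm.messagesBoundedBy N⟩
    · have : 0 < 4 / (4 + ε) := by positivity
      linarith
    · rw [h2δ]
      apply le_of_eq
      field_simp
      ring
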